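/- There are absolute constants $c>0$ and $C>0$ such that the following holds. Let $p\in(0,1]$, let $\lambda\in(0,1)$, and let $n$ be a positive integer with $n>c/(1-\lambda)^2$. Let $|\cdot|$ be a Euclidean norm on $\mathbb R^n$ with closed unit ball $D$ and unit sphere $S^{n-1}$, and let $\sigma$ be the normalized rotation invariant measure on $S^{n-1}$. Let $K\subset\mathbb R^n$ be a $p$-convex body, that is, a compact set with nonempty interior such that $tK\subset K$ for all $t\in[-1,1]$ and such that $ax+by\in K$ whenever $x,y\in K$, $a,b>0$ and $a^p+b^p=1$. Let $\|x\|_K=\inf\{r>0 : x\in rK\}$ be the gauge of $K$ and put $M_K=\int_{S^{n-1}}\|x\|_K\,d\sigma(x)$. Then there exists an orthogonal projection $P$ of rank $[\lambda n]$ (the integer part of $\lambda n$) such that $$PD\subset \frac{A_p\,M_K}{(1-\lambda)^{1+1/p}}\,PK,\qquad\text{where } A_p=C^{\frac{\ln(2/p)}{p}}.$$ -/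

import Mathlib

open MeasureTheory Metric

open scoped Pointwise ENNReal

namespace QuasiConvex

/-- A body: a compact set with nonempty interior such that `t • K ⊆ K` for all `t ∈ [-1, 1]`
(a centrally symmetric compact star body). -/
structure IsSymmStarBody {E : Type*} [NormedAddCommGroup E] [NormedSpace ℝ E] (K : Set E) :
    Prop where
  isCompact : IsCompact K
  interior_nonempty : (interior K).Nonempty
  smul_subset : ∀ t ∈ Set.Icc (-1 : ℝ) 1, t • K ⊆ K

/-- `K` is `p`-convex: `a x + b y ∈ K` whenever `x, y ∈ K`, `a, b > 0` and `a ^ p + b ^ p = 1`. -/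
def IsPConvex {E : Type*} [AddCommGroup E] [Module ℝ E] (p : ℝ) (K : Set E) : Prop :=
  ∀ x ∈ K, ∀ y ∈ K, ∀ a b : ℝ, 0 < a → 0 < b → a ^ p + b ^ p = 1 → a • x + b • y ∈ K

/-- The normalized rotation invariant measure on the Euclidean unit sphere. -/
noncomputable def sphereMeasure (E : Type*) [NormedAddCommGroup E] [InnerProductSpace ℝ E]
    [FiniteDimensional ℝ E] [MeasurableSpace E] [BorelSpace E] : Measure (sphere (0 : E) 1) :=
  ((volume : Measure E).toSphere Set.univ)⁻¹ • (volume : Measure E).toSphere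

/-- `M_K`, the mean over the Euclidean unit sphere of the gauge of `K`. -/
noncomputable def meanGauge {E : Type*} [NormedAddCommGroup E] [InnerProductSpace ℝ E]
    [FiniteDimensional ℝ E] [MeasurableSpace E] [BorelSpace E] (K : Set E) : ℝ :=
  ∫ x : sphere (0 : E) 1, gauge K (x : E) ∂(sphereMeasure E)

end QuasiConvex

/-!
The argument combines a covering estimate with a random projection.

*Covering.* Let `M` be the mean of the gauge of `K` over the sphere. In polar coordinates its
Gaussian mean is at most `√n * M` (`lintegral_gaussian_gauge_le`), so by Markov's inequality the
dilate of `K` by `2 * √n * M` carries half of the Gaussian mass. Translating a symmetric set by `a`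
costs at most a factor `exp (-‖a‖² / 2)` of Gaussian mass (`le_gaussian_translate`), which needs no
convexity. Packing translates gives a dual Sudakov inequality (`exists_cover`): the unit ball `D` is
covered by translates of `t • K` centered at at most `2 * exp (c * n * (4 ^ (1 / p) * M² / t²))`
points of `D`.

*Shrinking.* Let `m` be the codimension and `η = m / n`. A Haar random orthogonal projection of
codimension `m` fails to shrink a given vector by the factor `1 - η / 16` with probability at most
`exp (-m / 4)`. By invariance this probability is the Gaussian measure of a cone
(`measure_unitary_cone`), which is bounded by an exponential moment of a quadratic form
(`gaussian_cone_le`). Hence with `t` of order `2 ^ (1 / p) * M / √η` some projection `P` shrinks all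
centers of the covering simultaneously (`exists_shrinking_projection`).

*Iteration.* Projecting the covering gives `P D ⊆ (1 - η / 16) P D + t P K`. Iterating this inclusion
and summing in the `p`-convex set `P K` yields `P D ⊆ R • P K` with `R ^ p` of order
`t ^ p / (1 - (1 - η / 16) ^ p)`, that is `t ^ p / (p * η)` (`subset_smul_of_contraction`). Since
`η ≥ 1 - λ`, this is the claim, with room to spare in the power of `1 - λ` (`constant_bound`).
-/

namespace QuasiConvex

/-! ### Bodies, gauges and the mean gauge -/

section Convex

variable {E : Type*} [NormedAddCommGroup E] [NormedSpace ℝ E] {K : Set E} {p : ℝ}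

lemma IsPConvex.image {E' : Type*} [AddCommGroup E'] [Module ℝ E'] (hK : IsPConvex p K)
    (f : E →ₗ[ℝ] E') : IsPConvex p (f '' K) := by
  rintro _ ⟨x, hx, rfl⟩ _ ⟨y, hy, rfl⟩ a b ha hb hab
  exact ⟨a • x + b • y, hK x hx y hy a b ha hb hab, by simp⟩

lemma smul_subset_smul_of_le (hK : ∀ t ∈ Set.Icc (-1 : ℝ) 1, t • K ⊆ K) {r s : ℝ} (hr : 0 ≤ r)
    (hrs : r ≤ s) : r • K ⊆ s • K := by
  rcases hr.eq_or_lt with rfl | hr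
  · rcases hrs.eq_or_lt with rfl | hs
    · rfl
    rintro _ ⟨x, hx, rfl⟩
    refine ⟨(0 : ℝ) • x, hK 0 (by norm_num) ⟨x, hx, rfl⟩, by simp⟩
  · have hs : 0 < s := hr.trans_le hrs
    rintro _ ⟨x, hx, rfl⟩
    refine ⟨(r / s) • x, hK (r / s) ⟨?_, (div_le_one hs).2 hrs⟩ ⟨x, hx, rfl⟩, ?_⟩
    · have : 0 ≤ r / s := by positivity
      linarith
    · simp only [smul_smul]
      rw [mul_div_cancel₀ _ hs.ne']

/-- The `p`-triangle inequality for the gauge, phrased with dilates of the body. -/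
lemma IsPConvex.add_mem_smul (hK : IsPConvex p K) (hp : 0 < p) {a b : ℝ} (ha : 0 ≤ a) (hb : 0 ≤ b)
    {x y : E} (hx : x ∈ a • K) (hy : y ∈ b • K) : x + y ∈ (a ^ p + b ^ p) ^ (1 / p) • K := by
  rcases ha.eq_or_lt with rfl | ha
  · obtain ⟨x, _, rfl⟩ := hx
    rw [Real.zero_rpow hp.ne', zero_add, one_div, Real.rpow_rpow_inv hb hp.ne']
    simpa using hy
  rcases hb.eq_or_lt with rfl | hb
  · obtain ⟨y, _, rfl⟩ := hy
    rw [Real.zero_rpow hp.ne', add_zero, one_div, Real.rpow_rpow_inv ha.le hp.ne']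
    simpa using hx
  have hap : 0 < a ^ p := Real.rpow_pos_of_pos ha p
  have hbp : 0 < b ^ p := Real.rpow_pos_of_pos hb p
  set c := (a ^ p + b ^ p) ^ (1 / p) with hc
  have hc0 : 0 < c := Real.rpow_pos_of_pos (by positivity) _
  have hcp : c ^ p = a ^ p + b ^ p := by
    rw [hc, one_div, Real.rpow_inv_rpow (by positivity) hp.ne']
  obtain ⟨x, hx, rfl⟩ := hx
  obtain ⟨y, hy, rfl⟩ := hy
  refine ⟨(a / c) • x + (b / c) • y, hK x hx y hy _ _ (by positivity) (by positivity) ?_, ?_⟩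
  · rw [Real.div_rpow ha.le hc0.le, Real.div_rpow hb.le hc0.le, hcp, ← add_div,
      div_self (by positivity)]
  · simp only [smul_add, smul_smul, mul_div_cancel₀ _ hc0.ne']

lemma IsSymmStarBody.neg_mem (hb : IsSymmStarBody K) {x : E} (hx : x ∈ K) : -x ∈ K :=
  hb.smul_subset (-1) (by norm_num) ⟨x, hx, by simp⟩

/-- If `K` contains a ball around `x`, averaging it with `-x` gives a ball around `0`. -/
lemma IsPConvex.zero_mem_interior (hK : IsPConvex p K) (hb : IsSymmStarBody K) (hp : 0 < p) :
    (0 : E) ∈ interior K := by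
  obtain ⟨x, hx⟩ := hb.interior_nonempty
  obtain ⟨r, hr, hrK⟩ := Metric.isOpen_iff.1 isOpen_interior x hx
  set a : ℝ := (1 / 2) ^ (1 / p) with ha
  have ha0 : 0 < a := by positivity
  have hap : a ^ p = 1 / 2 := by
    rw [ha, one_div p, Real.rpow_inv_rpow (by norm_num) hp.ne']
  refine mem_interior.2 ⟨ball 0 (a * r), fun y hy => ?_, isOpen_ball, ?_⟩
  · have h1 : x + a⁻¹ • y ∈ K := by
      refine interior_subset (hrK ?_)
      have hy' : ‖y‖ < a * r := by simpa using hy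
      rw [mem_ball, dist_eq_norm, add_sub_cancel_left, norm_smul, norm_inv, Real.norm_eq_abs,
        abs_of_pos ha0, inv_mul_lt_iff₀ ha0]
      exact hy'
    have h2 : -x ∈ K := hb.neg_mem (interior_subset hx)
    have := hK _ h1 _ h2 a a ha0 ha0 (by rw [hap]; norm_num)
    simpa [smul_smul, ha0.ne'] using this
  · exact mem_ball_self (by positivity)

lemma IsSymmStarBody.neg_mem_smul (hb : IsSymmStarBody K) {r : ℝ} {x : E} (hx : x ∈ r • K) :
    -x ∈ r • K := by
  obtain ⟨y, hy, rfl⟩ := hx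
  exact ⟨-y, hb.neg_mem hy, by simp⟩

lemma IsPConvex.absorbent (hK : IsPConvex p K) (hb : IsSymmStarBody K) (hp : 0 < p) :
    Absorbent ℝ K :=
  absorbent_nhds_zero (mem_interior_iff_mem_nhds.1 (hK.zero_mem_interior hb hp))

lemma IsPConvex.gauge_le_iff (hK : IsPConvex p K) (hb : IsSymmStarBody K) (hp : 0 < p) {r : ℝ}
    (hr : 0 < r) {x : E} : gauge K x ≤ r ↔ x ∈ r • K := by
  refine ⟨fun h => ?_, fun h => gauge_le_of_mem hr.le h⟩
  have hcl : IsClosed K := hb.isCompact.isClosed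
  have habs := hK.absorbent hb hp
  -- `x` lies in `s • K` for every `s > r`; let `s` decrease to `r`.
  have hs : ∀ s, r < s → s⁻¹ • x ∈ K := by
    intro s hs
    obtain ⟨t, ht0, hts, htx⟩ := exists_lt_of_gauge_lt habs (h.trans_lt hs)
    have := smul_subset_smul_of_le hb.smul_subset ht0.le hts.le htx
    exact (Set.mem_smul_set_iff_inv_smul_mem₀ (ht0.trans hts).ne' _ _).1 this
  rw [Set.mem_smul_set_iff_inv_smul_mem₀ hr.ne']
  have ht : Filter.Tendsto (fun s : ℝ => s⁻¹ • x) (nhdsWithin r (Set.Ioi r)) (nhds (r⁻¹ • x)) :=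
    ((tendsto_inv₀ hr.ne').smul_const x).mono_left nhdsWithin_le_nhds
  exact hcl.mem_of_tendsto ht (Filter.eventually_of_mem self_mem_nhdsWithin hs)

variable [MeasurableSpace E] [BorelSpace E]

lemma IsPConvex.measurable_gauge (hK : IsPConvex p K) (hb : IsSymmStarBody K) (hp : 0 < p) :
    Measurable (gauge K) := by
  refine measurable_of_Iic fun r => ?_
  have hpos : ∀ r : ℝ, 0 < r → MeasurableSet (gauge K ⁻¹' Set.Iic r) := by
    intro r hr
    have : gauge K ⁻¹' Set.Iic r = r • K := by
      ext x; exact hK.gauge_le_iff hb hp hr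
    rw [this]
    exact (hb.isCompact.smul r).isClosed.measurableSet
  have : gauge K ⁻¹' Set.Iic r = ⋂ n : ℕ, gauge K ⁻¹' Set.Iic (r + 1 / ((n : ℝ) + 1)) := by
    ext x
    simp only [Set.mem_preimage, Set.mem_Iic, Set.mem_iInter]
    refine ⟨fun h n => h.trans (by simp; positivity), fun h => ?_⟩
    refine le_of_forall_pos_le_add fun ε hε => ?_
    obtain ⟨n, hn⟩ := exists_nat_one_div_lt hε
    linarith [h n]
  rcases lt_or_ge r 0 with hr | hr
  · convert MeasurableSet.empty
    ext x
    simpa using hr.trans_le (gauge_nonneg x)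
  · rw [this]
    exact MeasurableSet.iInter fun n => hpos _ (by positivity)

end Convex

section Mean

variable {E : Type*} [NormedAddCommGroup E] [InnerProductSpace ℝ E] [FiniteDimensional ℝ E]
  [MeasurableSpace E] [BorelSpace E] {K : Set E} {p : ℝ}

lemma isProbabilityMeasure_sphereMeasure [Nontrivial E] :
    IsProbabilityMeasure (sphereMeasure E) := by
  refine ⟨?_⟩
  rw [sphereMeasure, Measure.smul_apply, smul_eq_mul]
  refine ENNReal.inv_mul_cancel ?_ (measure_ne_top _ _)
  exact Measure.measure_univ_ne_zero.2 (volume : Measure E).toSphere_ne_zero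

lemma IsPConvex.integrable_gauge (hK : IsPConvex p K) (hb : IsSymmStarBody K) (hp : 0 < p)
    [Nontrivial E] :
    Integrable (fun x : sphere (0 : E) 1 => gauge K (x : E)) (sphereMeasure E) := by
  have := isProbabilityMeasure_sphereMeasure (E := E)
  obtain ⟨r, hr, hrK⟩ := Metric.isOpen_iff.1 isOpen_interior 0 (hK.zero_mem_interior hb hp)
  refine Integrable.of_bound
    ((hK.measurable_gauge hb hp).comp measurable_subtype_coe).aestronglyMeasurable (1 / r)
    (Filter.Eventually.of_forall fun x => ?_)
  have h := mul_gauge_le_norm (x := (x : E)) (hrK.trans interior_subset)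
  rw [Real.norm_eq_abs, abs_of_nonneg (gauge_nonneg _), le_div_iff₀ hr, mul_comm]
  simpa using h

lemma IsPConvex.meanGauge_pos (hK : IsPConvex p K) (hb : IsSymmStarBody K) (hp : 0 < p)
    [Nontrivial E] : 0 < meanGauge K := by
  have := isProbabilityMeasure_sphereMeasure (E := E)
  obtain ⟨R, hR0, hR⟩ := hb.isCompact.isBounded.subset_closedBall_lt 0 0
  have hle : ∀ x : sphere (0 : E) 1, 1 / R ≤ gauge K (x : E) := by
    intro x
    have := le_gauge_of_subset_closedBall (x := (x : E)) (hK.absorbent hb hp) hR0.le hR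
    simpa using this
  have h := integral_mono (integrable_const (1 / R)) (hK.integrable_gauge hb hp) hle
  have h1 : 0 < 1 / R := by positivity
  simp only [integral_const, probReal_univ, one_smul] at h
  exact h1.trans_le h

end Mean

/-! ### The Gaussian mean of the gauge -/

section Radial

lemma lintegral_volumeIoiPow (k : ℕ) {f : ℝ → ℝ} (hf : Measurable f) (hf0 : ∀ r, 0 < r → 0 ≤ f r)
    (hi : IntegrableOn (fun r => r ^ k * f r) (Set.Ioi 0)) :
    ∫⁻ r : Set.Ioi (0 : ℝ), ENNReal.ofReal (f r) ∂(Measure.volumeIoiPow k) =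
      ENNReal.ofReal (∫ r in Set.Ioi (0 : ℝ), r ^ k * f r) := by
  rw [Measure.volumeIoiPow, lintegral_withDensity_eq_lintegral_mul _ (by fun_prop) (by fun_prop),
    ofReal_integral_eq_lintegral_ofReal hi]
  · rw [← lintegral_subtype_comap measurableSet_Ioi]
    refine lintegral_congr fun r => ?_
    have := r.2
    simp only [Pi.mul_apply]
    rw [ENNReal.ofReal_mul (pow_nonneg this.le _)]
  · filter_upwards [ae_restrict_mem measurableSet_Ioi] with r hr
    exact mul_nonneg (pow_nonneg (le_of_lt hr) _) (hf0 r hr)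

lemma integrableOn_pow_mul_exp (k : ℕ) :
    IntegrableOn (fun r : ℝ => r ^ k * Real.exp (-r ^ 2 / 2)) (Set.Ioi 0) := by
  have := integrableOn_rpow_mul_exp_neg_mul_sq (b := 1 / 2) (by norm_num) (s := (k : ℝ))
    (by have : (0 : ℝ) ≤ k := k.cast_nonneg
        linarith)
  refine this.congr_fun (fun r _ => ?_) measurableSet_Ioi
  simp only [Real.rpow_natCast]
  congr 2
  ring

lemma integral_pow_mul_exp (k : ℕ) :
    ∫ r in Set.Ioi (0 : ℝ), r ^ k * Real.exp (-r ^ 2 / 2) =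
      (1 / 2) ^ (-((k : ℝ) + 1) / 2) * (1 / 2) * Real.Gamma (((k : ℝ) + 1) / 2) := by
  have := integral_rpow_mul_exp_neg_mul_rpow (p := 2) (q := k) (b := 1 / 2) (by norm_num)
    (by have : (0 : ℝ) ≤ k := k.cast_nonneg
        linarith) (by norm_num)
  rw [← this]
  refine setIntegral_congr_fun measurableSet_Ioi fun r _ => ?_
  simp only [Real.rpow_natCast, Real.rpow_two]
  congr 2
  ring

lemma integral_pow_add_two_mul_exp (k : ℕ) :
    ∫ r in Set.Ioi (0 : ℝ), r ^ (k + 2) * Real.exp (-r ^ 2 / 2) =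
      (k + 1) * ∫ r in Set.Ioi (0 : ℝ), r ^ k * Real.exp (-r ^ 2 / 2) := by
  rw [integral_pow_mul_exp, integral_pow_mul_exp]
  have h1 : (((k + 2 : ℕ) : ℝ) + 1) / 2 = ((k : ℝ) + 1) / 2 + 1 := by push_cast; ring
  have h2 : -(((k + 2 : ℕ) : ℝ) + 1) / 2 = -((k : ℝ) + 1) / 2 - 1 := by push_cast; ring
  rw [h1, h2, Real.Gamma_add_one (by positivity), Real.rpow_sub_one (by norm_num)]
  ring

/-- The radial part of a Gaussian vector in dimension `k + 1` has mean at most its root mean square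
`√(k + 1)`. -/
lemma integral_pow_succ_mul_exp_le (k : ℕ) :
    ∫ r in Set.Ioi (0 : ℝ), r ^ k * (r * Real.exp (-r ^ 2 / 2)) ≤
      √(k + 1) * ∫ r in Set.Ioi (0 : ℝ), r ^ k * Real.exp (-r ^ 2 / 2) := by
  set s := √((k : ℝ) + 1) with hs
  have hs0 : 0 < s := Real.sqrt_pos.2 (by positivity)
  have hss : s * s = k + 1 := Real.mul_self_sqrt (by positivity)
  set I := ∫ r in Set.Ioi (0 : ℝ), r ^ k * Real.exp (-r ^ 2 / 2) with hI
  have hbound : ∫ r in Set.Ioi (0 : ℝ), r ^ k * (r * Real.exp (-r ^ 2 / 2)) ≤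
      ∫ r in Set.Ioi (0 : ℝ), (1 / (2 * s) * (r ^ (k + 2) * Real.exp (-r ^ 2 / 2)) +
        s / 2 * (r ^ k * Real.exp (-r ^ 2 / 2))) := by
    refine setIntegral_mono_on ?_
      (((integrableOn_pow_mul_exp (k + 2)).const_mul _).add
        ((integrableOn_pow_mul_exp k).const_mul _)) measurableSet_Ioi fun r hr => ?_
    · refine (integrableOn_pow_mul_exp (k + 1)).congr_fun (fun r _ => ?_) measurableSet_Ioi
      simp only
      ring
    -- `r ≤ r² / (2s) + s / 2` is the arithmetic-geometric mean inequality.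
    · have hr0 : 0 < r := hr
      have key : r ≤ 1 / (2 * s) * r ^ 2 + s / 2 := by
        have : 1 / (2 * s) * r ^ 2 + s / 2 - r = (r - s) ^ 2 / (2 * s) := by
          field_simp
          ring
        have h2 : 0 ≤ (r - s) ^ 2 / (2 * s) := by positivity
        linarith
      have h3 : 0 ≤ r ^ k * Real.exp (-r ^ 2 / 2) := by positivity
      calc r ^ k * (r * Real.exp (-r ^ 2 / 2)) = r * (r ^ k * Real.exp (-r ^ 2 / 2)) := by ring
        _ ≤ (1 / (2 * s) * r ^ 2 + s / 2) * (r ^ k * Real.exp (-r ^ 2 / 2)) := by gcongr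
        _ = _ := by ring
  rw [integral_add ((integrableOn_pow_mul_exp (k + 2)).const_mul _)
    ((integrableOn_pow_mul_exp k).const_mul _), integral_const_mul, integral_const_mul,
    integral_pow_add_two_mul_exp, ← hI, ← hss] at hbound
  refine hbound.trans (le_of_eq ?_)
  field_simp
  ring

end Radial

section Gaussian

variable (E : Type*) [NormedAddCommGroup E] [InnerProductSpace ℝ E] [FiniteDimensional ℝ E]
  [MeasurableSpace E] [BorelSpace E]

/-- The Gaussian measure on `E` with density `exp (-‖x‖² / 2)`, not normalized: its total mass
`(2π) ^ (dim E / 2)` is never needed. -/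
noncomputable def gaussian : Measure E :=
  volume.withDensity fun x => ENNReal.ofReal (Real.exp (-‖x‖ ^ 2 / 2))

variable {E}

lemma lintegral_gaussian {f : E → ℝ≥0∞} (hf : Measurable f) :
    ∫⁻ x, f x ∂(gaussian E) = ∫⁻ x, ENNReal.ofReal (Real.exp (-‖x‖ ^ 2 / 2)) * f x := by
  rw [gaussian, lintegral_withDensity_eq_lintegral_mul _ (by fun_prop) hf]
  rfl

lemma gaussian_univ_ne_zero : gaussian E Set.univ ≠ 0 := by
  rw [gaussian, Measure.measure_univ_ne_zero, Ne, withDensity_eq_zero_iff (by fun_prop)]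
  intro h
  have : ∀ᵐ x : E, False := by
    filter_upwards [h] with x hx
    simp only [Pi.zero_apply, ENNReal.ofReal_eq_zero] at hx
    exact absurd hx (not_le.2 (Real.exp_pos _))
  simp only [Filter.eventually_false_iff_eq_bot, ae_eq_bot] at this
  exact NeZero.ne _ this

lemma integrable_exp_neg_sq_div_two :
    Integrable fun x : E => Real.exp (-‖x‖ ^ 2 / 2) := by
  have := (GaussianFourier.integrable_cexp_neg_mul_sq_norm_add (V := E) (b := 1 / 2) (by norm_num)
    0 0).norm
  refine this.congr (Filter.Eventually.of_forall fun x => ?_)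
  simp only [Complex.norm_exp]
  congr 1
  simp [← Complex.ofReal_pow]
  ring

instance : IsFiniteMeasure (gaussian E) := by
  refine isFiniteMeasure_withDensity_ofReal ?_
  exact integrable_exp_neg_sq_div_two.hasFiniteIntegral

/-- Integration in polar coordinates of a product of an angular and a radial function. -/
lemma lintegral_polar [Nontrivial E] {u : E → ℝ≥0∞} {v : ℝ → ℝ≥0∞} (hu : Measurable u)
    (hv : Measurable v) :
    ∫⁻ x : E, u (‖x‖⁻¹ • x) * v ‖x‖ =
      (∫⁻ x : sphere (0 : E) 1, u x ∂(volume : Measure E).toSphere) *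
        ∫⁻ r : Set.Ioi (0 : ℝ), v r ∂(Measure.volumeIoiPow (Module.finrank ℝ E - 1)) := by
  have h1 : ∫⁻ x : E, u (‖x‖⁻¹ • x) * v ‖x‖ =
      ∫⁻ x : ({0}ᶜ : Set E), u (‖(x : E)‖⁻¹ • (x : E)) * v ‖(x : E)‖
        ∂((volume : Measure E).comap (↑)) := by
    rw [lintegral_subtype_comap (measurableSet_singleton (0 : E)).compl
      fun x => u (‖x‖⁻¹ • x) * v ‖x‖, restrict_compl_singleton]
  have h2 := (volume : Measure E).measurePreserving_homeomorphUnitSphereProd.lintegral_comp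
    (f := fun y => u y.1 * v y.2) (by fun_prop)
  have h3 := lintegral_prod_mul (μ := (volume : Measure E).toSphere)
    (ν := Measure.volumeIoiPow (Module.finrank ℝ E - 1))
    (hu.comp (measurable_subtype_coe (p := (· ∈ sphere (0 : E) 1)))).aemeasurable
    (hv.comp (measurable_subtype_coe (p := (· ∈ Set.Ioi (0 : ℝ))))).aemeasurable
  simp only [Function.comp_apply] at h3
  rw [h1, ← h3, ← h2]
  simp only [homeomorphUnitSphereProd_apply_fst_coe, homeomorphUnitSphereProd_apply_snd_coe]

lemma lintegral_toSphere_gauge [Nontrivial E] {K : Set E} {p : ℝ} (hK : IsPConvex p K)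
    (hb : IsSymmStarBody K) (hp : 0 < p) :
    ∫⁻ x : sphere (0 : E) 1, ENNReal.ofReal (gauge K x) ∂(volume : Measure E).toSphere =
      (volume : Measure E).toSphere Set.univ * ENNReal.ofReal (meanGauge K) := by
  rw [meanGauge, ofReal_integral_eq_lintegral_ofReal (hK.integrable_gauge hb hp)
    (Filter.Eventually.of_forall fun x => gauge_nonneg _), sphereMeasure, lintegral_smul_measure,
    smul_eq_mul, ← mul_assoc, ENNReal.mul_inv_cancel ?_ (measure_ne_top _ _), one_mul]
  exact Measure.measure_univ_ne_zero.2 (volume : Measure E).toSphere_ne_zero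

/-- The Gaussian mean of the gauge is at most `√n` times its mean over the sphere. -/
lemma lintegral_gaussian_gauge_le [Nontrivial E] {K : Set E} {p : ℝ} (hK : IsPConvex p K)
    (hb : IsSymmStarBody K) (hp : 0 < p) :
    ∫⁻ x, ENNReal.ofReal (gauge K x) ∂(gaussian E) ≤
      ENNReal.ofReal (√(Module.finrank ℝ E) * meanGauge K) * gaussian E Set.univ := by
  have hn : Module.finrank ℝ E - 1 + 1 = Module.finrank ℝ E :=
    Nat.sub_add_cancel Module.finrank_pos
  set k := Module.finrank ℝ E - 1 with hk
  have hgm : Measurable fun x : E => ENNReal.ofReal (gauge K x) :=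
    (hK.measurable_gauge hb hp).ennreal_ofReal
  have hexp : Measurable fun r : ℝ => Real.exp (-r ^ 2 / 2) := by fun_prop
  have hrexp : Measurable fun r : ℝ => r * Real.exp (-r ^ 2 / 2) := by fun_prop
  have h1 : ∫⁻ x, ENNReal.ofReal (gauge K x) ∂(gaussian E) =
      ((volume : Measure E).toSphere Set.univ * ENNReal.ofReal (meanGauge K)) *
        ENNReal.ofReal (∫ r in Set.Ioi (0 : ℝ), r ^ k * (r * Real.exp (-r ^ 2 / 2))) := by
    rw [← lintegral_toSphere_gauge hK hb hp, ← lintegral_volumeIoiPow k hrexp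
      (fun r hr => by positivity) ?_, hk, ← lintegral_polar hgm hrexp.ennreal_ofReal,
      lintegral_gaussian hgm]
    · refine lintegral_congr fun x => ?_
      have hx : gauge K x = ‖x‖ * gauge K (‖x‖⁻¹ • x) := by
        rcases eq_or_ne x 0 with rfl | hx
        · simp
        rw [gauge_smul_of_nonneg (by positivity), smul_eq_mul, mul_inv_cancel_left₀ (by simpa)]
      rw [← ENNReal.ofReal_mul (Real.exp_pos _).le, ← ENNReal.ofReal_mul (gauge_nonneg _)]
      nth_rewrite 1 [hx]
      congr 1
      ring
    · refine (integrableOn_pow_mul_exp (k + 1)).congr_fun (fun r _ => ?_) measurableSet_Ioi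
      simp only
      ring
  have h2 : gaussian E Set.univ = (volume : Measure E).toSphere Set.univ *
      ENNReal.ofReal (∫ r in Set.Ioi (0 : ℝ), r ^ k * Real.exp (-r ^ 2 / 2)) := by
    rw [← lintegral_volumeIoiPow k hexp (fun r hr => (Real.exp_pos _).le)
      (integrableOn_pow_mul_exp k), hk, ← lintegral_one (μ := (volume : Measure E).toSphere),
      ← lintegral_polar measurable_const hexp.ennreal_ofReal, ← lintegral_one,
      lintegral_gaussian measurable_const]
    simp
  have hM : 0 ≤ meanGauge K := (hK.meanGauge_pos hb hp).le
  have h3 := ENNReal.ofReal_le_ofReal (integral_pow_succ_mul_exp_le k)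
  have hc : (k : ℝ) + 1 = Module.finrank ℝ E := by rw [← hn]; push_cast; ring
  rw [ENNReal.ofReal_mul (by positivity), hc] at h3
  rw [h1, h2, ENNReal.ofReal_mul (by positivity)]
  refine (mul_le_mul_right h3 _).trans (le_of_eq ?_)
  ring

end Gaussian
/-! ### Gaussian translates and covering numbers -/

section Packing

variable {E : Type*} [NormedAddCommGroup E] [InnerProductSpace ℝ E] [FiniteDimensional ℝ E]
  [MeasurableSpace E] [BorelSpace E]

/-- Shifting a symmetric set by `a` decreases its Gaussian measure at most by the factor
`exp (-‖a‖² / 2)`. No convexity is needed: average the density over `x` and `-x`. -/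
lemma le_gaussian_translate {B : Set E} (hB : MeasurableSet B) (hsymm : ∀ x ∈ B, -x ∈ B) (a : E) :
    ENNReal.ofReal (Real.exp (-‖a‖ ^ 2 / 2)) * gaussian E B ≤ gaussian E {x | x - a ∈ B} := by
  have hBm : Measurable (B.indicator (fun _ => (1 : ℝ≥0∞))) := measurable_const.indicator hB
  have hneg : ∀ x, B.indicator (fun _ => (1 : ℝ≥0∞)) (-x) = B.indicator (fun _ => 1) x := by
    intro x
    by_cases hx : x ∈ B
    · simp [hx, hsymm x hx]
    · have : -x ∉ B := fun h => hx (by simpa using hsymm _ h)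
      simp [hx, this]
  have h1 : gaussian E {x | x - a ∈ B} =
      ∫⁻ x, ENNReal.ofReal (Real.exp (-‖x + a‖ ^ 2 / 2)) * B.indicator (fun _ => 1) x := by
    have hm : MeasurableSet {x | x - a ∈ B} := (measurable_id.sub_const a) hB
    rw [← lintegral_indicator_one hm, lintegral_gaussian (measurable_one.indicator hm),
      ← lintegral_add_right_eq_self _ a]
    refine lintegral_congr fun x => ?_
    congr 1
    by_cases hx : x ∈ B <;> simp [hx]
  have h2 : gaussian E {x | x - a ∈ B} =
      ∫⁻ x, ENNReal.ofReal (Real.exp (-‖-x + a‖ ^ 2 / 2)) * B.indicator (fun _ => 1) x := by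
    rw [h1, ← lintegral_neg_eq_self]
    simp only [hneg]
  have h3 : gaussian E B =
      ∫⁻ x, ENNReal.ofReal (Real.exp (-‖x‖ ^ 2 / 2)) * B.indicator (fun _ => 1) x := by
    rw [← lintegral_indicator_one hB, lintegral_gaussian (measurable_one.indicator hB)]
    rfl
  have h4 : 2 * (ENNReal.ofReal (Real.exp (-‖a‖ ^ 2 / 2)) * gaussian E B) ≤
      2 * gaussian E {x | x - a ∈ B} := by
    rw [two_mul (gaussian E _)]
    nth_rewrite 1 [h1]
    rw [h2, h3, ← lintegral_add_left (by fun_prop),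
      ← lintegral_const_mul _ (by fun_prop), ← lintegral_const_mul _ (by fun_prop)]
    refine lintegral_mono fun x => ?_
    rw [← add_mul, ← mul_assoc, ← mul_assoc, ← ENNReal.ofReal_ofNat 2,
      ← ENNReal.ofReal_mul (by norm_num), ← ENNReal.ofReal_mul (by positivity),
      ← ENNReal.ofReal_add (by positivity) (by positivity)]
    refine mul_le_mul_left (ENNReal.ofReal_le_ofReal ?_) _
    rw [norm_add_sq_real, norm_add_sq_real, norm_neg, inner_neg_left]
    set c := inner ℝ x a
    have e1 : Real.exp (-(‖x‖ ^ 2 + 2 * c + ‖a‖ ^ 2) / 2) =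
        Real.exp (-‖a‖ ^ 2 / 2) * Real.exp (-‖x‖ ^ 2 / 2) * Real.exp (-c) := by
      rw [← Real.exp_add, ← Real.exp_add]; ring_nf
    have e2 : Real.exp (-(‖x‖ ^ 2 + 2 * -c + ‖a‖ ^ 2) / 2) =
        Real.exp (-‖a‖ ^ 2 / 2) * Real.exp (-‖x‖ ^ 2 / 2) * Real.exp c := by
      rw [← Real.exp_add, ← Real.exp_add]; ring_nf
    rw [e1, e2]
    have h5 : 2 ≤ Real.exp (-c) + Real.exp c := by
      linarith [Real.add_one_le_exp c, Real.add_one_le_exp (-c)]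
    have h6 : 0 ≤ Real.exp (-‖a‖ ^ 2 / 2) * Real.exp (-‖x‖ ^ 2 / 2) := by positivity
    nlinarith [mul_le_mul_of_nonneg_left h5 h6]
  exact (ENNReal.mul_le_mul_iff_right two_ne_zero ENNReal.ofNat_ne_top).1 h4

variable {K : Set E} {p : ℝ}

/-- At least half of the Gaussian mass lies in the dilate of `K` by twice the Gaussian mean of the
gauge (Markov's inequality). -/
lemma gaussian_half_le [Nontrivial E] (hK : IsPConvex p K) (hb : IsSymmStarBody K) (hp : 0 < p) :
    (gaussian E).real Set.univ / 2 ≤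
      (gaussian E).real ((2 * √(Module.finrank ℝ E) * meanGauge K) • K) := by
  have hM := hK.meanGauge_pos hb hp
  have hn : 0 < √(Module.finrank ℝ E : ℝ) :=
    Real.sqrt_pos.2 (by exact_mod_cast Module.finrank_pos)
  set A := √(Module.finrank ℝ E : ℝ) * meanGauge K with hA
  have hA0 : 0 < A := by positivity
  have hL : 2 * √(Module.finrank ℝ E : ℝ) * meanGauge K = 2 * A := by rw [hA]; ring
  rw [hL]
  have hgm : Measurable fun x : E => ENNReal.ofReal (gauge K x) :=
    (hK.measurable_gauge hb hp).ennreal_ofReal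
  have h1 := (mul_meas_ge_le_lintegral (μ := gaussian E) hgm (ENNReal.ofReal (2 * A))).trans
    (lintegral_gaussian_gauge_le hK hb hp)
  have h2 := ENNReal.toReal_mono (by finiteness) h1
  rw [ENNReal.toReal_mul, ENNReal.toReal_mul, ENNReal.toReal_ofReal (by positivity),
    ENNReal.toReal_ofReal (by positivity)] at h2
  have h3 : (gaussian E).real Set.univ ≤
      (gaussian E).real ((2 * A) • K) +
        (gaussian E).real {x | ENNReal.ofReal (2 * A) ≤ ENNReal.ofReal (gauge K x)} := by
    refine (measureReal_mono (fun x _ => ?_)).trans (measureReal_union_le _ _)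
    by_cases hx : gauge K x ≤ 2 * A
    · exact Or.inl ((hK.gauge_le_iff hb hp (by positivity)).1 hx)
    · exact Or.inr (ENNReal.ofReal_le_ofReal (not_le.1 hx).le)
  change 2 * A * (gaussian E).real _ ≤ A * (gaussian E).real _ at h2
  have h4 : 2 * (gaussian E).real {x | ENNReal.ofReal (2 * A) ≤ ENNReal.ofReal (gauge K x)} ≤
      (gaussian E).real Set.univ := by
    refine le_of_mul_le_mul_left ?_ hA0
    linarith
  linarith

/-- Packing bound in the dual Sudakov inequality: the Gaussian translates of a fixed dilate of `K`
around the rescaled points are disjoint, and each has a definite mass. -/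
lemma card_separated_le [Nontrivial E] (hK : IsPConvex p K) (hb : IsSymmStarBody K) (hp : 0 < p)
    {t : ℝ} (ht : 0 < t) (s : Finset E) (hs : ∀ x ∈ s, ‖x‖ ≤ 1)
    (hsep : ∀ x ∈ s, ∀ y ∈ s, x ≠ y → x - y ∉ t • K) :
    (s.card : ℝ) ≤ 2 * Real.exp
      ((2 ^ (1 / p) * (2 * √(Module.finrank ℝ E) * meanGauge K) / t) ^ 2 / 2) := by
  have hhalf := gaussian_half_le hK hb hp
  have hM := hK.meanGauge_pos hb hp
  have hn : 0 < √(Module.finrank ℝ E : ℝ) :=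
    Real.sqrt_pos.2 (by exact_mod_cast Module.finrank_pos)
  set L := 2 * √(Module.finrank ℝ E : ℝ) * meanGauge K with hL
  have hL0 : 0 < L := by positivity
  set r := 2 ^ (1 / p) * L / t with hr
  have hr0 : 0 < r := by positivity
  have hBm : MeasurableSet (L • K) := (hb.isCompact.smul L).isClosed.measurableSet
  have hm : ∀ a : E, MeasurableSet {x | x - a ∈ L • K} := fun a => (measurable_id.sub_const a) hBm
  have hdisj : Set.PairwiseDisjoint (s : Set E) fun a : E => {x | x - r • a ∈ L • K} := by
    intro a ha b hb' hab
    refine Set.disjoint_left.2 fun x hxa hxb => hsep b hb' a ha hab.symm ?_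
    have h := hK.add_mem_smul hp hL0.le hL0.le hxa (hb.neg_mem_smul hxb)
    have e1 : x - r • a + -(x - r • b) = r • (b - a) := by rw [smul_sub]; abel
    have e2 : (L ^ p + L ^ p) ^ (1 / p) = r * t := by
      rw [← two_mul, Real.mul_rpow (by norm_num) (by positivity), one_div p,
        Real.rpow_rpow_inv hL0.le hp.ne', hr, one_div, div_mul_cancel₀ _ ht.ne']
    rw [e1, e2, mul_smul] at h
    exact (Set.smul_mem_smul_set_iff₀ hr0.ne' _ _).1 h
  have hsum : ∑ a ∈ s, (gaussian E).real {x | x - r • a ∈ L • K} ≤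
      (gaussian E).real Set.univ := by
    rw [← measureReal_biUnion_finset hdisj fun a _ => hm (r • a)]
    exact measureReal_mono (Set.subset_univ _)
  have hU : 0 < (gaussian E).real Set.univ :=
    ENNReal.toReal_pos gaussian_univ_ne_zero (measure_ne_top _ _)
  have hterm : ∀ a ∈ s, Real.exp (-r ^ 2 / 2) * ((gaussian E).real Set.univ / 2) ≤
      (gaussian E).real {x | x - r • a ∈ L • K} := by
    intro a ha
    have h1 := ENNReal.toReal_mono (measure_ne_top _ _)
      (le_gaussian_translate hBm (fun x => hb.neg_mem_smul) (r • a))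
    rw [ENNReal.toReal_mul, ENNReal.toReal_ofReal (Real.exp_pos _).le] at h1
    refine le_trans (mul_le_mul ?_ hhalf (by positivity) (by positivity)) h1
    refine Real.exp_le_exp.2 ?_
    have h2 : ‖r • a‖ ≤ r := by
      rw [norm_smul, Real.norm_eq_abs, abs_of_pos hr0]
      exact mul_le_of_le_one_right hr0.le (hs a ha)
    have h3 : ‖r • a‖ ^ 2 ≤ r ^ 2 := by gcongr
    linarith
  have h1 := (Finset.card_nsmul_le_sum s _ _ hterm).trans hsum
  rw [nsmul_eq_mul] at h1
  have h2 : (s.card : ℝ) * Real.exp (-r ^ 2 / 2) ≤ 2 := by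
    refine le_of_mul_le_mul_right ?_ hU
    linarith
  calc (s.card : ℝ) = s.card * Real.exp (-r ^ 2 / 2) * Real.exp (r ^ 2 / 2) := by
        rw [mul_assoc, ← Real.exp_add]; ring_nf; simp
    _ ≤ _ := by gcongr

/-- Dual Sudakov inequality for `p`-convex bodies: a covering of the Euclidean ball by translates of
`t • K` with few centers. -/
lemma exists_cover [Nontrivial E] (hK : IsPConvex p K) (hb : IsSymmStarBody K) (hp : 0 < p)
    {t : ℝ} (ht : 0 < t) :
    ∃ s : Finset E, (∀ x ∈ s, ‖x‖ ≤ 1) ∧ (∀ x : E, ‖x‖ ≤ 1 → ∃ y ∈ s, x - y ∈ t • K) ∧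
      (s.card : ℝ) ≤ 2 * Real.exp
        ((2 ^ (1 / p) * (2 * √(Module.finrank ℝ E) * meanGauge K) / t) ^ 2 / 2) := by
  classical
  set N := 2 * Real.exp ((2 ^ (1 / p) * (2 * √(Module.finrank ℝ E) * meanGauge K) / t) ^ 2 / 2)
  let S : Set ℕ := {k | ∃ s : Finset E, s.card = k ∧ (∀ x ∈ s, ‖x‖ ≤ 1) ∧
    ∀ x ∈ s, ∀ y ∈ s, x ≠ y → x - y ∉ t • K}
  have hbdd : BddAbove S := by
    refine ⟨⌊N⌋₊, ?_⟩
    rintro k ⟨s, rfl, h1, h2⟩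
    exact Nat.le_floor (card_separated_le hK hb hp ht s h1 h2)
  obtain ⟨s, hcard, h1, h2⟩ := Nat.sSup_mem (s := S) ⟨0, ∅, by simp⟩ hbdd
  refine ⟨s, h1, fun x hx => ?_, card_separated_le hK hb hp ht s h1 h2⟩
  by_contra! hcon
  -- Otherwise `x` could be added to the maximal separated set `s`.
  have h0 : (0 : E) ∈ t • K :=
    ⟨0, interior_subset (hK.zero_mem_interior hb hp), by simp⟩
  have hxs : x ∉ s := fun h => hcon x h (by simpa using h0)
  have : s.card + 1 ∈ S := by
    refine ⟨insert x s, Finset.card_insert_of_notMem hxs, ?_, ?_⟩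
    · intro y hy
      rcases Finset.mem_insert.1 hy with rfl | hy
      exacts [hx, h1 y hy]
    · intro y hy z hz hyz
      rcases Finset.mem_insert.1 hy with rfl | hys <;>
        rcases Finset.mem_insert.1 hz with rfl | hzs
      · exact absurd rfl hyz
      · exact hcon z hzs
      · intro h
        exact hcon y hys (by simpa using hb.neg_mem_smul h)
      · exact h2 y hys z hzs hyz
  have := le_csSup hbdd this
  omega

end Packing
/-! ### Gaussian measure of cones around a subspace -/

section RandomSubspace

variable {E : Type*} [NormedAddCommGroup E] [InnerProductSpace ℝ E] [FiniteDimensional ℝ E]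
  [MeasurableSpace E] [BorelSpace E]

lemma integrable_exp_neg_sum_sq {ι : Type*} [Fintype ι] (b : OrthonormalBasis ι ℝ E)
    {c : ι → ℝ} (hc : ∀ i, 0 < c i) :
    Integrable fun x : E => Real.exp (-∑ i, c i * (b.repr x i) ^ 2) := by
  have h := Integrable.fintype_prod (μ := fun _ : ι => (volume : Measure ℝ))
    (f := fun i x => Real.exp (-c i * x ^ 2)) fun i => integrable_exp_neg_mul_sq (hc i)
  have hmp := (PiLp.volume_preserving_ofLp ι).comp b.measurePreserving_repr
  refine (hmp.integrable_comp_of_integrable h).congr (Filter.Eventually.of_forall fun x => ?_)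
  simp [← Real.exp_sum]

lemma integral_exp_neg_sum_sq {ι : Type*} [Fintype ι] (b : OrthonormalBasis ι ℝ E)
    (c : ι → ℝ) :
    ∫ x : E, Real.exp (-∑ i, c i * (b.repr x i) ^ 2) = ∏ i, √(Real.pi / c i) := by
  have h := integral_fintype_prod_volume_eq_prod (fun i x => Real.exp (-c i * x ^ 2))
  simp only [integral_gaussian] at h
  rw [← h, ← (PiLp.volume_preserving_ofLp ι).integral_comp
    (MeasurableEquiv.toLp 2 (ι → ℝ)).symm.measurableEmbedding,
    ← b.measurePreserving_repr.integral_comp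
      b.repr.toHomeomorph.toMeasurableEquiv.measurableEmbedding]
  simp [← Real.exp_sum]

/-- Chernoff bound: a Gaussian vector has, except with probability `exp (-m / 4)`, a non-negligible
part of its length on `m` fixed coordinates out of `n`, namely the fraction `m / (8 n)`. -/
lemma gaussian_cone_le {ι : Type*} [Fintype ι] [DecidableEq ι] [Nonempty ι]
    (b : OrthonormalBasis ι ℝ E) (s : Finset ι) :
    (gaussian E).real {x | (1 - ((sᶜ.card : ℝ) / Fintype.card ι) / 8) * ‖x‖ ^ 2 <
        ∑ i ∈ s, (b.repr x i) ^ 2} ≤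
      Real.exp (-(sᶜ.card : ℝ) / 4) * (gaussian E).real Set.univ := by
  set m : ℝ := ((sᶜ.card : ℕ) : ℝ) with hm
  set n : ℝ := ((Fintype.card ι : ℕ) : ℝ) with hn
  have hn0 : 0 < n := by rw [hn]; exact_mod_cast Fintype.card_pos
  have hm0 : 0 ≤ m := by rw [hm]; positivity
  have hmn : m ≤ n := by
    rw [hm, hn]; exact_mod_cast Finset.card_le_univ _
  set η := m / n with hη
  have hη0 : 0 ≤ η := by positivity
  have hη1 : η ≤ 1 := (div_le_one hn0).2 hmn
  set ρ := 1 - η / 8 with hρ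
  have hnorm : ∀ x : E, ‖x‖ ^ 2 = ∑ i, (b.repr x i) ^ 2 := fun x => by
    rw [← b.repr.norm_map, EuclideanSpace.real_norm_sq_eq]
  -- The weight `exp (|Px|² - ρ |x|²)` times the Gaussian density is again Gaussian, with
  -- coefficient `c i` at the `i`-th coordinate.
  let c : ι → ℝ := fun i => if i ∈ s then 1 / 2 - η / 8 else 1 / 2 + ρ
  have hc : ∀ i, 0 < c i := by
    intro i
    simp only [c]
    split_ifs <;> linarith
  have hcx : ∀ x : E, -∑ i, c i * (b.repr x i) ^ 2 =
      -‖x‖ ^ 2 / 2 + (∑ i ∈ s, (b.repr x i) ^ 2 - ρ * ‖x‖ ^ 2) := by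
    intro x
    rw [hnorm x, ← Finset.sum_add_sum_compl s (fun i => c i * _),
      ← Finset.sum_add_sum_compl s (fun i => (b.repr x i) ^ 2)]
    have e1 : ∑ i ∈ s, c i * (b.repr x i) ^ 2 = (1 / 2 - η / 8) * ∑ i ∈ s, (b.repr x i) ^ 2 := by
      rw [Finset.mul_sum]
      refine Finset.sum_congr rfl fun i hi => ?_
      simp [c, hi]
    have e2 : ∑ i ∈ sᶜ, c i * (b.repr x i) ^ 2 = (1 / 2 + ρ) * ∑ i ∈ sᶜ, (b.repr x i) ^ 2 := by
      rw [Finset.mul_sum]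
      refine Finset.sum_congr rfl fun i hi => ?_
      simp [c, Finset.mem_compl.1 hi]
    rw [e1, e2, hρ]
    ring
  have hUniv : (gaussian E).real Set.univ = ∏ i : ι, √(Real.pi / (1 / 2)) := by
    rw [← integral_exp_neg_sum_sq b (fun _ => 1 / 2)]
    rw [measureReal_def, gaussian, withDensity_apply _ MeasurableSet.univ, setLIntegral_univ,
      ← ofReal_integral_eq_lintegral_ofReal integrable_exp_neg_sq_div_two
        (Filter.Eventually.of_forall fun x => (Real.exp_pos _).le),
      ENNReal.toReal_ofReal (integral_nonneg fun x => (Real.exp_pos _).le)]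
    congr 1
    ext x
    rw [hnorm x, ← Finset.mul_sum]
    ring_nf
  set A := {x : E | ρ * ‖x‖ ^ 2 < ∑ i ∈ s, (b.repr x i) ^ 2} with hA
  have hAm : MeasurableSet A := by
    have hcont : Continuous fun x : E => ∑ i ∈ s, (b.repr x i) ^ 2 := by fun_prop
    exact (isOpen_lt (by fun_prop) hcont).measurableSet
  have hle : (gaussian E).real A ≤ ∏ i, √(Real.pi / c i) := by
    rw [← integral_exp_neg_sum_sq b c, measureReal_def, gaussian, withDensity_apply _ hAm,
      ← ofReal_integral_eq_lintegral_ofReal integrable_exp_neg_sq_div_two.integrableOn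
        (Filter.Eventually.of_forall fun x => (Real.exp_pos _).le),
      ENNReal.toReal_ofReal (integral_nonneg fun x => (Real.exp_pos _).le)]
    refine (setIntegral_mono_on integrable_exp_neg_sq_div_two.integrableOn
      (integrable_exp_neg_sum_sq b hc).integrableOn hAm fun x hx => ?_).trans
      (setIntegral_le_integral (integrable_exp_neg_sum_sq b hc)
        (Filter.Eventually.of_forall fun x => (Real.exp_pos _).le))
    rw [hcx x]
    refine Real.exp_le_exp.2 ?_
    have : ρ * ‖x‖ ^ 2 < ∑ i ∈ s, (b.repr x i) ^ 2 := hx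
    linarith
  refine hle.trans ?_
  rw [hUniv, ← Finset.prod_mul_prod_compl s fun i => √(Real.pi / c i)]
  have f1 : ∀ i ∈ s, √(Real.pi / c i) ≤ Real.exp (η / 4) * √(Real.pi / (1 / 2)) := by
    intro i hi
    have e : Real.pi / c i = (1 - η / 4)⁻¹ * (Real.pi / (1 / 2)) := by
      have e' : c i = (1 - η / 4) * (1 / 2) := by
        simp only [c, hi, if_true]
        ring
      rw [e', div_mul_eq_div_div, div_eq_inv_mul Real.pi, mul_div_assoc]
    rw [e, Real.sqrt_mul (inv_nonneg.2 (by linarith))]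
    refine mul_le_mul_of_nonneg_right (Real.sqrt_le_iff.2 ⟨(Real.exp_pos _).le, ?_⟩) (by positivity)
    rw [← Real.exp_nat_mul, Nat.cast_ofNat, show 2 * (η / 4) = η / 2 by ring]
    refine le_trans ?_ (Real.add_one_le_exp (η / 2))
    rw [inv_le_iff_one_le_mul₀ (by linarith)]
    nlinarith
  have f2 : ∀ i ∈ sᶜ, √(Real.pi / c i) ≤ Real.exp (-1 / 2) * √(Real.pi / (1 / 2)) := by
    intro i hi
    have e : Real.pi / c i = (1 + 2 * ρ)⁻¹ * (Real.pi / (1 / 2)) := by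
      have : 1 / 2 + ρ ≠ 0 := by linarith
      have : 1 + 2 * ρ ≠ 0 := by linarith
      simp only [c, Finset.mem_compl.1 hi, if_false]
      field_simp
    rw [e, Real.sqrt_mul (inv_nonneg.2 (by linarith))]
    refine mul_le_mul_of_nonneg_right (Real.sqrt_le_iff.2 ⟨(Real.exp_pos _).le, ?_⟩) (by positivity)
    rw [← Real.exp_nat_mul]
    have e3 : ((2 : ℕ) : ℝ) * (-1 / 2) = -1 := by norm_num
    rw [e3, Real.exp_neg]
    refine inv_anti₀ (Real.exp_pos _) ?_
    have := Real.exp_one_lt_d9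
    linarith
  have g1 := Finset.prod_le_prod (fun i _ => Real.sqrt_nonneg _) f1
  have g2 := Finset.prod_le_prod (fun i _ => Real.sqrt_nonneg _) f2
  refine (mul_le_mul g1 g2 (Finset.prod_nonneg fun i _ => Real.sqrt_nonneg _)
    (Finset.prod_nonneg fun i _ => by positivity)).trans ?_
  rw [Finset.prod_mul_distrib, Finset.prod_mul_distrib, mul_mul_mul_comm,
    Finset.prod_mul_prod_compl, Finset.prod_const, Finset.prod_const, ← Real.exp_nat_mul,
    ← Real.exp_nat_mul, ← Real.exp_add]
  refine mul_le_mul_of_nonneg_right (Real.exp_le_exp.2 ?_)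
    (Finset.prod_nonneg fun i _ => Real.sqrt_nonneg _)
  have h1 : (s.card : ℝ) ≤ n := by
    rw [hn]; exact_mod_cast Finset.card_le_univ _
  have h2 : n * η = m := by rw [hη]; field_simp
  nlinarith [mul_le_mul_of_nonneg_right h1 hη0]

end RandomSubspace
/-! ### Random orthogonal projections -/

section Haar

variable {E : Type*} [NormedAddCommGroup E] [InnerProductSpace ℝ E]

lemma compactSpace_unitary [FiniteDimensional ℝ E] [CompleteSpace E] : CompactSpace (unitary (E →L[ℝ] E)) := by
  refine isCompact_iff_compactSpace.1 (Metric.isCompact_of_isClosed_isBounded isClosed_unitary ?_)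
  refine (isBounded_iff_forall_norm_le.2 ⟨1, fun u hu => ?_⟩)
  refine ContinuousLinearMap.opNorm_le_bound _ zero_le_one fun x => ?_
  rw [one_mul]
  exact (Unitary.norm_map (⟨u, hu⟩ : unitary (E →L[ℝ] E)) x).le

lemma exists_unitary_apply_eq [CompleteSpace E] {x y : E} (h : ‖x‖ = ‖y‖) :
    ∃ V : unitary (E →L[ℝ] E), (V : E →L[ℝ] E) x = y := by
  refine ⟨Unitary.linearIsometryEquiv.symm (Submodule.reflection (Submodule.span ℝ {x - y})ᗮ), ?_⟩
  exact Submodule.reflection_sub h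

lemma norm_sq_starProjection_span [FiniteDimensional ℝ E] {ι : Type*} [Fintype ι] [DecidableEq ι]
    (b : OrthonormalBasis ι ℝ E) (s : Finset ι) (x : E) :
    ‖(Submodule.span ℝ (b '' s)).starProjection x‖ ^ 2 = ∑ i ∈ s, (b.repr x i) ^ 2 := by
  have h : (Submodule.span ℝ (b '' s)).starProjection x = ∑ i ∈ s, b.repr x i • b i := by
    refine Submodule.eq_starProjection_of_mem_of_inner_eq_zero
      (Submodule.sum_mem _ fun i hi => Submodule.smul_mem _ _
        (Submodule.subset_span ⟨i, hi, rfl⟩)) fun w hw => ?_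
    induction hw using Submodule.span_induction with
    | mem w hw =>
      obtain ⟨i, hi, rfl⟩ := hw
      rw [inner_sub_left, b.orthonormal.inner_left_sum _ hi, b.repr_apply_apply, real_inner_comm]
      simp
    | zero => simp
    | add y z _ _ hy hz => rw [inner_add_right, hy, hz, add_zero]
    | smul a y _ hy => rw [inner_smul_right, hy, mul_zero]
  rw [h, ← real_inner_self_eq_norm_sq, b.orthonormal.inner_sum]
  simp [sq]

variable [FiniteDimensional ℝ E] [MeasurableSpace E] [BorelSpace E]

lemma gaussian_preimage_unitary [CompleteSpace E] (u : unitary (E →L[ℝ] E)) {A : Set E}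
    (hA : MeasurableSet A) : gaussian E ((u : E →L[ℝ] E) ⁻¹' A) = gaussian E A := by
  have hu : MeasurableSet ((u : E →L[ℝ] E) ⁻¹' A) := (u : E →L[ℝ] E).measurable hA
  rw [← lintegral_indicator_one hA, ← lintegral_indicator_one hu,
    lintegral_gaussian (measurable_one.indicator hA),
    lintegral_gaussian (measurable_one.indicator hu),
    ← (Unitary.linearIsometryEquiv u).measurePreserving.lintegral_comp
      (f := fun x => ENNReal.ofReal (Real.exp (-‖x‖ ^ 2 / 2)) * A.indicator 1 x)
      ((by fun_prop : Measurable fun x : E => ENNReal.ofReal (Real.exp (-‖x‖ ^ 2 / 2))).mul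
        (measurable_one.indicator hA))]
  refine lintegral_congr fun x => ?_
  simp only [LinearIsometryEquiv.norm_map]
  rfl

/-- Under the Haar probability measure of the orthogonal group, the image of a fixed nonzero vector
hits a cone with the same probability as a Gaussian vector. -/
lemma measure_unitary_cone [CompleteSpace E] [Nontrivial E]
    [MeasurableSpace (unitary (E →L[ℝ] E))] [BorelSpace (unitary (E →L[ℝ] E))]
    (μ : Measure (unitary (E →L[ℝ] E))) [IsProbabilityMeasure μ] [μ.IsMulLeftInvariant]
    {A : Set E} (hA : IsOpen A) (hcone : ∀ c : ℝ, 0 < c → ∀ x, c • x ∈ A ↔ x ∈ A)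
    {x : E} (hx : x ≠ 0) :
    μ {u | ((u⁻¹ : unitary (E →L[ℝ] E)) : E →L[ℝ] E) x ∈ A} * gaussian E Set.univ =
      gaussian E A := by
  have := FiniteDimensional.proper_real (E →L[ℝ] E)
  -- By invariance the probability does not depend on the vector.
  have hconst : ∀ g : E, g ≠ 0 → μ {u | ((u⁻¹ : unitary (E →L[ℝ] E)) : E →L[ℝ] E) g ∈ A} =
      μ {u | ((u⁻¹ : unitary (E →L[ℝ] E)) : E →L[ℝ] E) x ∈ A} := by
    intro g hg
    have hx0 : 0 < ‖x‖ := norm_pos_iff.2 hx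
    have hg0 : 0 < ‖g‖ := norm_pos_iff.2 hg
    obtain ⟨V, hV⟩ := exists_unitary_apply_eq (x := x) (y := (‖x‖ / ‖g‖) • g) (by
      rw [norm_smul, Real.norm_eq_abs, abs_of_pos (by positivity), div_mul_cancel₀ _ hg0.ne'])
    rw [← measure_preimage_mul μ V⁻¹ {u | ((u⁻¹ : unitary (E →L[ℝ] E)) : E →L[ℝ] E) x ∈ A}]
    congr 1
    ext u
    simp only [Set.mem_ofPred_eq, Set.preimage_ofPred_eq, mul_inv_rev, inv_inv]
    change _ ↔ ((u⁻¹ : unitary (E →L[ℝ] E)) : E →L[ℝ] E) ((V : E →L[ℝ] E) x) ∈ A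
    rw [hV, map_smul, hcone _ (by positivity)]
  have hS : MeasurableSet {z : E × unitary (E →L[ℝ] E) |
      ((z.2⁻¹ : unitary (E →L[ℝ] E)) : E →L[ℝ] E) z.1 ∈ A} := by
    have hcont : Continuous fun z : E × unitary (E →L[ℝ] E) =>
        ((z.2⁻¹ : unitary (E →L[ℝ] E)) : E →L[ℝ] E) z.1 :=
      (continuous_subtype_val.comp (continuous_inv.comp continuous_snd)).clm_apply continuous_fst
    exact (hA.preimage hcont).measurableSet
  have h1 := Measure.prod_apply (μ := gaussian E) (ν := μ) hS
  have h2 := Measure.prod_apply_symm (μ := gaussian E) (ν := μ) hS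
  have hae : ∀ᵐ g ∂(gaussian E), g ≠ 0 := by
    refine (withDensity_absolutelyContinuous _ _).ae_le ?_
    exact Measure.ae_ne volume 0
  rw [h1] at h2
  have h3 : ∀ᵐ g ∂(gaussian E), μ (Prod.mk g ⁻¹' {z : E × unitary (E →L[ℝ] E) |
      ((z.2⁻¹ : unitary (E →L[ℝ] E)) : E →L[ℝ] E) z.1 ∈ A}) =
      μ {u | ((u⁻¹ : unitary (E →L[ℝ] E)) : E →L[ℝ] E) x ∈ A} := by
    filter_upwards [hae] with g hg using hconst g hg
  rw [lintegral_congr_ae h3, lintegral_const] at h2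
  rw [h2]
  have h4 : ∀ u : unitary (E →L[ℝ] E), gaussian E ((fun g => (g, u)) ⁻¹'
      {z : E × unitary (E →L[ℝ] E) | ((z.2⁻¹ : unitary (E →L[ℝ] E)) : E →L[ℝ] E) z.1 ∈ A}) =
      gaussian E A := fun u => gaussian_preimage_unitary u⁻¹ hA.measurableSet
  simp only [h4, lintegral_const, measure_univ, mul_one]

/-- A random projection of codimension `m = n - k` shortens all points of a set with fewer than
`exp (m / 4)` elements. -/
lemma exists_shrinking_projection [Nontrivial E] {k : ℕ} (hk : k ≤ Module.finrank ℝ E)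
    (s : Finset E)
    (hs : (s.card : ℝ) * Real.exp (-((Module.finrank ℝ E - k : ℕ) : ℝ) / 4) < 1) :
    ∃ F : Submodule ℝ E, Module.finrank ℝ F = k ∧ ∀ x ∈ s, ‖F.starProjection x‖ ^ 2 ≤
      (1 - (((Module.finrank ℝ E - k : ℕ) : ℝ) / Module.finrank ℝ E) / 8) * ‖x‖ ^ 2 := by
  classical
  have := FiniteDimensional.complete ℝ E
  have := compactSpace_unitary (E := E)
  let _ : MeasurableSpace (unitary (E →L[ℝ] E)) := borel _
  have : BorelSpace (unitary (E →L[ℝ] E)) := ⟨rfl⟩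
  let μ : Measure (unitary (E →L[ℝ] E)) := Measure.haarMeasure ⊤
  have hμ : IsProbabilityMeasure μ := ⟨by
    have := Measure.haarMeasure_self (K₀ := (⊤ : TopologicalSpace.PositiveCompacts
      (unitary (E →L[ℝ] E))))
    simpa using this⟩
  set n := Module.finrank ℝ E with hn
  have hn0 : 0 < n := Module.finrank_pos
  have : Nonempty (Fin n) := ⟨⟨0, hn0⟩⟩
  let b : OrthonormalBasis (Fin n) ℝ E := stdOrthonormalBasis ℝ E
  obtain ⟨T, _, hT⟩ := Finset.exists_subset_card_eq (s := (Finset.univ : Finset (Fin n)))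
    (n := k) (by simpa using hk)
  have hTc : Tᶜ.card = n - k := by rw [Finset.card_compl, hT, Fintype.card_fin]
  set m := n - k
  set A := {x : E | (1 - ((m : ℝ) / n) / 8) * ‖x‖ ^ 2 < ∑ i ∈ T, (b.repr x i) ^ 2} with hA
  have hAo : IsOpen A := by
    have hcont : Continuous fun x : E => ∑ i ∈ T, (b.repr x i) ^ 2 := by fun_prop
    exact isOpen_lt (by fun_prop) hcont
  have hcone : ∀ c : ℝ, 0 < c → ∀ x, c • x ∈ A ↔ x ∈ A := by
    intro c hc x
    have hc2 : 0 < c ^ 2 := by positivity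
    simp only [hA, Set.mem_ofPred_eq, map_smul, PiLp.smul_apply, smul_eq_mul, norm_smul, mul_pow,
      ← Finset.mul_sum, Real.norm_eq_abs, sq_abs]
    rw [mul_left_comm, mul_lt_mul_iff_right₀ hc2]
  have hgA : (gaussian E).real A ≤ Real.exp (-(m : ℝ) / 4) * (gaussian E).real Set.univ := by
    have := gaussian_cone_le b T
    rwa [hTc, Fintype.card_fin] at this
  have hU : 0 < (gaussian E).real Set.univ :=
    ENNReal.toReal_pos gaussian_univ_ne_zero (measure_ne_top _ _)
  have hbad : ∀ x ∈ s, μ.real {u | ((u⁻¹ : unitary (E →L[ℝ] E)) : E →L[ℝ] E) x ∈ A} ≤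
      Real.exp (-(m : ℝ) / 4) := by
    intro x _
    rcases eq_or_ne x 0 with rfl | hx
    · simp [hA, (Real.exp_pos _).le]
    have h := congrArg ENNReal.toReal (measure_unitary_cone μ hAo hcone hx)
    rw [ENNReal.toReal_mul] at h
    change μ.real _ * (gaussian E).real _ = (gaussian E).real _ at h
    rw [← h] at hgA
    exact le_of_mul_le_mul_right hgA hU
  obtain ⟨u, hu⟩ : ∃ u : unitary (E →L[ℝ] E),
      ∀ x ∈ s, ((u⁻¹ : unitary (E →L[ℝ] E)) : E →L[ℝ] E) x ∉ A := by
    by_contra! hcon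
    have h1 : μ.real Set.univ ≤
        ∑ x ∈ s, μ.real {u | ((u⁻¹ : unitary (E →L[ℝ] E)) : E →L[ℝ] E) x ∈ A} := by
      refine (measureReal_mono (fun u _ => ?_) (measure_ne_top _ _)).trans
        (measureReal_biUnion_finset_le s _)
      obtain ⟨x, hx, hxA⟩ := hcon u
      exact Set.mem_biUnion hx hxA
    have h2 := Finset.sum_le_card_nsmul s _ _ hbad
    rw [nsmul_eq_mul] at h2
    rw [probReal_univ] at h1
    linarith
  let b' : OrthonormalBasis (Fin n) ℝ E := b.map (Unitary.linearIsometryEquiv u)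
  refine ⟨Submodule.span ℝ (b' '' T), ?_, fun x hx => ?_⟩
  · have hli : LinearIndepOn ℝ id ((T.image b' : Finset E) : Set E) := by
      rw [Finset.coe_image]
      exact (b'.orthonormal.linearIndependent.linearIndepOn (T : Set (Fin n))).id_image
    rw [← Finset.coe_image, finrank_span_finset_eq_card hli,
      Finset.card_image_of_injective _ b'.orthonormal.linearIndependent.injective, hT]
  · rw [norm_sq_starProjection_span]
    have h := hu x hx
    rw [hA, Set.mem_ofPred_eq, not_lt, Unitary.norm_map] at h
    exact h

end Haar
/-! ### Iteration and constants -/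

/-- If every point of `B` splits as a point of `ρ • B` plus a point of `t • Q`, then iterating the
splitting absorbs `B` into a dilate of `Q`; the `p`-convexity of `Q` replaces the geometric series
`∑ ρ ^ j` by `(∑ ρ ^ (p j)) ^ (1 / p)`. -/
lemma subset_smul_of_contraction {E : Type*} [NormedAddCommGroup E] [NormedSpace ℝ E] {p : ℝ}
    (hp : 0 < p) {B Q : Set E} (hQ : IsPConvex p Q) (hstar : ∀ t ∈ Set.Icc (-1 : ℝ) 1, t • Q ⊆ Q)
    {s ρ t : ℝ} (hs : 0 ≤ s) (hB : B ⊆ s • Q) (hρ0 : 0 ≤ ρ) (hρ1 : ρ < 1) (ht : 0 < t)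
    (hsplit : ∀ x ∈ B, ∃ y ∈ B, ∃ z ∈ t • Q, x = ρ • y + z) :
    B ⊆ (2 * t ^ p / (1 - ρ ^ p)) ^ (1 / p) • Q := by
  let T : Set ℝ := {τ | 0 ≤ τ ∧ B ⊆ τ ^ (1 / p) • Q}
  have hTne : T.Nonempty := by
    refine ⟨s ^ p, by positivity, ?_⟩
    rwa [one_div, Real.rpow_rpow_inv hs hp.ne']
  have hTbdd : BddBelow T := ⟨0, fun τ hτ => hτ.1⟩
  have hstep : ∀ τ ∈ T, ρ ^ p * τ + t ^ p ∈ T := by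
    rintro τ ⟨hτ0, hτ⟩
    refine ⟨by positivity, fun x hx => ?_⟩
    obtain ⟨y, hy, z, hz, rfl⟩ := hsplit x hx
    have h1 : ρ • y ∈ (ρ * τ ^ (1 / p)) • Q := by
      rw [mul_smul]
      exact Set.smul_mem_smul_set (hτ hy)
    have h2 := hQ.add_mem_smul hp (by positivity) ht.le h1 hz
    rwa [Real.mul_rpow hρ0 (by positivity), one_div p, Real.rpow_inv_rpow hτ0 hp.ne',
      ← one_div p] at h2
  have hρp : 0 ≤ ρ ^ p := by positivity
  have hρp1 : 0 < 1 - ρ ^ p := sub_pos.2 (Real.rpow_lt_one hρ0 hρ1 hp)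
  have htp : 0 < t ^ p := by positivity
  have hle : sInf T ≤ ρ ^ p * sInf T + t ^ p := by
    rcases hρp.eq_or_lt with h0 | hpos
    · obtain ⟨τ, hτ⟩ := hTne
      have := csInf_le hTbdd (hstep τ hτ)
      simpa [← h0] using this
    · have : (sInf T - t ^ p) / ρ ^ p ≤ sInf T := by
        refine le_csInf hTne fun τ hτ => ?_
        rw [div_le_iff₀ hpos]
        linarith [csInf_le hTbdd (hstep τ hτ)]
      rw [div_le_iff₀ hpos] at this
      linarith
  have hlt : sInf T < 2 * t ^ p / (1 - ρ ^ p) := by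
    rw [lt_div_iff₀ hρp1]
    linarith
  obtain ⟨τ, hτ, hτlt⟩ := exists_lt_of_csInf_lt hTne hlt
  refine hτ.2.trans (smul_subset_smul_of_le hstar (Real.rpow_nonneg hτ.1 _) ?_)
  exact Real.rpow_le_rpow hτ.1 hτlt.le (by positivity)

/-- The final estimate of the constants, with `M` the mean of the gauge, `η` the relative
codimension and `δ = 1 - λ`. -/
lemma constant_bound {p δ η M : ℝ} (hp : 0 < p) (hp1 : p ≤ 1) (hδ : 0 < δ) (hδη : δ ≤ η)
    (hη : η ≤ 1) (hM : 0 < M) :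
    (2 * (4 * 2 ^ (1 / p) * M / √η) ^ p / (1 - (1 - η / 16) ^ p)) ^ (1 / p) ≤
      Real.exp 8 ^ (Real.log (2 / p) / p) * M / δ ^ (1 + 1 / p) := by
  have hη0 : 0 < η := hδ.trans_le hδη
  set t := 4 * 2 ^ (1 / p) * M / √η with ht
  have hsη : 0 < √η := Real.sqrt_pos.2 hη0
  have ht0 : 0 < t := by positivity
  have hbern : p * η / 16 ≤ 1 - (1 - η / 16) ^ p := by
    have := rpow_one_add_le_one_add_mul_self (s := -(η / 16)) (by linarith) hp.le hp1
    rw [← sub_eq_add_neg] at this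
    linarith
  have h1 : 2 * t ^ p / (1 - (1 - η / 16) ^ p) ≤ (32 / p) * (1 / δ) * t ^ p := by
    calc _ ≤ 2 * t ^ p / (p * η / 16) := by gcongr
      _ = (32 / p) * (1 / η) * t ^ p := by field_simp; norm_num
      _ ≤ _ := by gcongr
  have ht1 : t ≤ 4 ^ (1 / p) * 2 ^ (1 / p) * M / δ := by
    have h4 : (4 : ℝ) ≤ 4 ^ (1 / p) := by
      refine Real.self_le_rpow_of_one_le (by norm_num) ?_
      rw [le_div_iff₀ hp]
      linarith
    -- The power `1 / 2` of `η` available here is weakened to the power `1` in the statement.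
    have h5 : δ ≤ √η := hδη.trans (Real.le_sqrt_of_sq_le (by nlinarith))
    rw [ht]
    gcongr
  have hc : 32 / p * 4 * 2 ≤ (2 / p) ^ 8 := by
    have hp8 : p ^ 8 ≤ p := by
      simpa using pow_le_pow_of_le_one hp.le hp1 (show 1 ≤ 8 by norm_num)
    calc 32 / p * 4 * 2 = 256 / p := by ring
      _ ≤ 256 / p ^ 8 := by gcongr
      _ = _ := by rw [div_pow]; norm_num
  have hC : Real.exp 8 ^ (Real.log (2 / p) / p) = ((2 / p) ^ 8) ^ (1 / p) := by
    rw [← Real.exp_mul, Real.rpow_def_of_pos (by positivity), Real.log_pow]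
    congr 1
    push_cast
    ring
  have h0 : 0 ≤ 2 * t ^ p / (1 - (1 - η / 16) ^ p) := by
    have : 0 ≤ p * η / 16 := by positivity
    have := this.trans hbern
    positivity
  calc (2 * t ^ p / (1 - (1 - η / 16) ^ p)) ^ (1 / p)
      ≤ ((32 / p) * (1 / δ) * t ^ p) ^ (1 / p) := Real.rpow_le_rpow h0 h1 (by positivity)
    _ = (32 / p) ^ (1 / p) * (1 / δ) ^ (1 / p) * t := by
        rw [Real.mul_rpow (by positivity) (by positivity),
          Real.mul_rpow (by positivity) (by positivity), one_div p,
          Real.rpow_rpow_inv ht0.le hp.ne']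
    _ ≤ (32 / p) ^ (1 / p) * (1 / δ) ^ (1 / p) * (4 ^ (1 / p) * 2 ^ (1 / p) * M / δ) := by gcongr
    _ = (32 / p * 4 * 2) ^ (1 / p) * M / δ ^ (1 + 1 / p) := by
        rw [Real.mul_rpow (x := 32 / p * 4) (by positivity) (by positivity),
          Real.mul_rpow (x := 32 / p) (by positivity) (by positivity), Real.rpow_add hδ,
          Real.rpow_one, Real.div_rpow zero_le_one hδ.le, Real.one_rpow]
        have : δ ^ (1 / p) ≠ 0 := by positivity
        field_simp
    _ ≤ _ := by
        rw [hC]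
        gcongr

end QuasiConvex

open QuasiConvex

theorem theorem2 :
    ∃ c C : ℝ, 0 < c ∧ 0 < C ∧
      ∀ (p : ℝ), 0 < p → p ≤ 1 →
      ∀ (lam : ℝ), 0 < lam → lam < 1 →
      ∀ (n : ℕ), c / (1 - lam) ^ 2 < (n : ℝ) →
      ∀ (E : Type) [NormedAddCommGroup E] [InnerProductSpace ℝ E] [FiniteDimensional ℝ E]
        [MeasurableSpace E] [BorelSpace E], Module.finrank ℝ E = n →
      ∀ (K : Set E), QuasiConvex.IsSymmStarBody K → QuasiConvex.IsPConvex p K →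
      ∃ F : Submodule ℝ E, Module.finrank ℝ F = ⌊lam * (n : ℝ)⌋₊ ∧
        F.starProjection '' Metric.closedBall (0 : E) 1 ⊆
          (C ^ (Real.log (2 / p) / p) * QuasiConvex.meanGauge K /
            (1 - lam) ^ (1 + 1 / p)) • (F.starProjection '' K) := by
  refine ⟨8, Real.exp 8, by norm_num, Real.exp_pos _, ?_⟩
  intro p hp hp1 lam hlam hlam1 n hn E _ _ _ _ _ hE K hb hK
  have hδ : 0 < 1 - lam := by linarith
  have hn0 : (0 : ℝ) < n := lt_trans (by positivity) hn
  have hnpos : 0 < n := by exact_mod_cast hn0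
  have : Nontrivial E := Module.nontrivial_of_finrank_pos (R := ℝ) (by omega)
  set k := ⌊lam * (n : ℝ)⌋₊ with hk
  have hkle : (k : ℝ) ≤ lam * n := Nat.floor_le (by positivity)
  have hkn : k ≤ n := by
    have : (k : ℝ) ≤ n := hkle.trans (by nlinarith)
    exact_mod_cast this
  have hmk : ((n - k : ℕ) : ℝ) = n - k := Nat.cast_sub hkn
  set m : ℝ := ((n - k : ℕ) : ℝ) with hm
  have hmδ : (1 - lam) * n ≤ m := by rw [hmk]; linarith
  -- The assumption on `n` makes `2 * exp (-m / 8)` smaller than `1`.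
  have hm8 : 8 < m := by
    rw [div_lt_iff₀ (by positivity)] at hn
    nlinarith [mul_pos hδ hn0]
  set η := m / n with hη
  have hδη : 1 - lam ≤ η := by rwa [hη, le_div_iff₀ hn0]
  have hη0 : 0 < η := hδ.trans_le hδη
  have hη1 : η ≤ 1 := by
    rw [hη, div_le_one hn0, hmk]
    linarith [(k.cast_nonneg : (0 : ℝ) ≤ k)]
  have hM := hK.meanGauge_pos hb hp
  set M := meanGauge K with hMdef
  have hsη : 0 < √η := Real.sqrt_pos.2 hη0
  set t := 4 * 2 ^ (1 / p) * M / √η with ht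
  have ht0 : 0 < t := by positivity
  -- The radius `t` is chosen so that the covering number is of order `exp (m / 8)`.
  obtain ⟨s, hs1, hscov, hscard⟩ := exists_cover hK hb hp ht0
  have hexp : (2 ^ (1 / p) * (2 * √(Module.finrank ℝ E) * meanGauge K) / t) ^ 2 / 2 = m / 8 := by
    have e1 : 2 ^ (1 / p) * (2 * √(Module.finrank ℝ E : ℝ) * meanGauge K) / t =
        √n * √η / 2 := by
      rw [hE, ht, ← hMdef]
      have : (2 : ℝ) ^ (1 / p) ≠ 0 := by positivity
      field_simp
      norm_num
    rw [e1, div_pow, mul_pow, Real.sq_sqrt hn0.le, Real.sq_sqrt hη0.le, hη]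
    field_simp
    norm_num
  rw [hexp] at hscard
  have hsmall : (s.card : ℝ) * Real.exp (-((Module.finrank ℝ E - k : ℕ) : ℝ) / 4) < 1 := by
    rw [hE, ← hm]
    calc (s.card : ℝ) * Real.exp (-m / 4) ≤ 2 * Real.exp (m / 8) * Real.exp (-m / 4) := by gcongr
      _ = 2 * Real.exp (-(m / 8)) := by rw [mul_assoc, ← Real.exp_add]; ring_nf
      _ < 2 * Real.exp (-1) := by
        have : -(m / 8) < -1 := by linarith
        gcongr
      _ < 1 := by
        have := Real.exp_neg_one_lt_d9
        linarith
  obtain ⟨F, hF, hFs⟩ := exists_shrinking_projection (k := k) (by omega) s hsmall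
  refine ⟨F, hF, ?_⟩
  rw [hE, ← hm, ← hη] at hFs
  have hstar : ∀ a ∈ Set.Icc (-1 : ℝ) 1, a • (F.starProjection '' K) ⊆ F.starProjection '' K := by
    intro a ha
    rw [← image_smul_set]
    exact Set.image_mono (hb.smul_subset a ha)
  have hQ : IsPConvex p (F.starProjection '' K) := hK.image (F.starProjection : E →ₗ[ℝ] E)
  obtain ⟨r, hr, hrK⟩ := Metric.nhds_basis_closedBall.mem_iff.1
    (mem_interior_iff_mem_nhds.1 (hK.zero_mem_interior hb hp))
  have hinit : F.starProjection '' closedBall (0 : E) 1 ⊆ r⁻¹ • (F.starProjection '' K) := by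
    rw [← image_smul_set]
    refine Set.image_mono fun x hx => ?_
    rw [Set.mem_smul_set_iff_inv_smul_mem₀ (by positivity), inv_inv]
    refine hrK ?_
    rw [mem_closedBall_zero_iff] at hx ⊢
    rw [norm_smul, Real.norm_eq_abs, abs_of_pos hr]
    exact mul_le_of_le_one_right hr.le hx
  have hρ0 : 0 < 1 - η / 16 := by linarith
  have hsplit : ∀ x ∈ F.starProjection '' closedBall (0 : E) 1,
      ∃ y ∈ F.starProjection '' closedBall (0 : E) 1,
        ∃ z ∈ t • (F.starProjection '' K), x = (1 - η / 16) • y + z := by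
    rintro _ ⟨x, hx, rfl⟩
    rw [mem_closedBall_zero_iff] at hx
    obtain ⟨y, hys, hxy⟩ := hscov x hx
    refine ⟨(1 - η / 16)⁻¹ • F.starProjection y, ⟨(1 - η / 16)⁻¹ • F.starProjection y, ?_, ?_⟩,
      F.starProjection (x - y), ?_, ?_⟩
    · have h1 : ‖F.starProjection y‖ ≤ 1 - η / 16 := by
        refine le_of_sq_le_sq ?_ hρ0.le
        have h2 := hFs y hys
        have h3 : ‖y‖ ^ 2 ≤ 1 := pow_le_one₀ (norm_nonneg _) (hs1 y hys)
        nlinarith [mul_le_mul_of_nonneg_left h3 (show 0 ≤ 1 - η / 8 by linarith)]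
      rw [mem_closedBall_zero_iff, norm_smul, norm_inv, Real.norm_eq_abs, abs_of_pos hρ0,
        inv_mul_le_iff₀ hρ0]
      simpa using h1
    · rw [map_smul]
      congr 1
      exact Submodule.starProjection_eq_self_iff.2 (F.starProjection_apply_mem y)
    · rw [← image_smul_set]
      exact Set.mem_image_of_mem _ hxy
    · rw [smul_smul, mul_inv_cancel₀ hρ0.ne', one_smul, map_sub]
      abel
  have hρ1 : 1 - η / 16 < 1 := by linarith
  refine (subset_smul_of_contraction hp hQ hstar (by positivity) hinit hρ0.le hρ1 ht0
    hsplit).trans (smul_subset_smul_of_le hstar ?_ (constant_bound hp hp1 hδ hδη hη1 hM))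
  have : (1 - η / 16) ^ p ≤ 1 := Real.rpow_le_one hρ0.le hρ1.le hp.le
  have : 0 ≤ 1 - (1 - η / 16) ^ p := by linarith
  positivity
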